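/- **Setting.** Let $V$ be a finite-dimensional real vector space with a finite increasing filtration $W$, non-degenerate bilinear forms $\langle\,,\rangle_w$ on $Gr^W_w=W_w/W_{w-1}$, symmetric for $w$ even and antisymmetric for $w$ odd, and Hodge numbers $h^{p,q}=h^{q,p}\ge 0$ with $\dim Gr^W_w=\sum_{p+q=w}h^{p,q}$. Let $\mathcal M$ be the classifying space of all finite decreasing filtrations $F$ of $V_{\mathbb C}$ such that $(F,W)$ is a mixed Hodge structure for which each $F(Gr^W_w)$ is a Hodge structure of weight $w$ polarized by $\langle\,,\rangle_w$ with Hodge numbers $h^{p,q}$. For $A=\mathbb R,\mathbb C$ let $G_A$ be the group of $A$-linear automorphisms of $V_A$ that preserve $W$ and act on each $Gr^W_{w,A}$ by isometries of $\langle\,,\rangle_w$, and let $\mathfrak g_{\mathbb C}=\mathrm{Lie}(G_{\mathbb C})$. **Metrics.** Let $F\in\mathcal M$, let $V_{\mathbb C}=\bigoplus I^{p,q}$ be the Deligne bigrading of $(F,W)$, with induced bigrading $\mathfrak g_{\mathbb C}=\bigoplus\mathfrak g^{p,q}$. The mixed Hodge metric $h_F$ on $V_{\mathbb C}$ makes the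 $I^{p,q}$ mutually orthogonal and satisfies $h_F(u,v)=i^{p-q}\langle gr(u),gr(\bar v)\rangle_{p+q}$ for $u,v\in I^{p,q}$; it induces $\|\alpha\|_F^2=\mathrm{Tr}(\alpha\alpha^*)$ on $\mathrm{End}(V_{\mathbb C})$. The tangent space $T_F(\mathcal M)=\mathfrak g_{\mathbb C}/\mathfrak g_{\mathbb C}^F$, where $\mathfrak g_{\mathbb C}^F$ is the stabilizer of $F$, is identified with $q_F=\bigoplus_{p<0,\,p+q\le 0}\mathfrak g^{p,q}$, and $L_{g*}$ is the differential of $F\mapsto g.F$. **Twisting function.** Let $\Lambda^{-1,-1}$ be the space of $X\in\mathrm{End}(V_{\mathbb C})$ with $X(I^{p,q})\subseteq\bigoplus_{a<p,\,b<q}I^{a,b}$ for all $p,q$. Let $\delta$ be the unique real element of $\Lambda^{-1,-1}$ for which $(e^{-i\delta}.F,W)$ is split over $\mathbb R$. Let $\zeta,\eta\in\Lambda^{-1,-1}$ be the unique pair of real elements with $$e^{i\delta}=e^{\zeta}\Big(1+\sum_{k\ge1}P_k\Big),\qquad P_0=1,\quad P_k=-\frac1k\sum_{j=1}^kP_{k-j}C_{j+1},\qquad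 C_{j+1}=i\sum_{p,q\ge1}b^{\,j-1}_{p-1,q-1}\,\eta^{-p,-q},$$ where $(1-x)^p(1+x)^q=\sum_k b^k_{p,q}x^k$ and $\eta^{-p,-q}$ are the Hodge components of $\eta$ with respect to $(e^{-i\delta}.F,W)$. Let $\epsilon=\epsilon(F,W)\in\Lambda^{-1,-1}$ be defined by $e^{\epsilon}=e^{i\delta}e^{-\zeta}$ (so that $(e^{-\epsilon}.F,W)$ is the canonical $\mathbb R$-split mixed Hodge structure attached to $(F,W)$ by the $SL_2$-orbit theorem), let $\epsilon=\sum_{p,q<0}\epsilon^{p,q}$ be its decomposition into Hodge components with respect to $(F,W)$, and put $$\tau(F)=1+\sum_{p,q<0}\|\epsilon^{p,q}\|_F^{-2/(p+q)} .$$ **Twisted metric.** The twisted metric on $V_{\mathbb C}$ at $F$ is obtained from the mixed Hodge metric by scaling the norm on $I^{p,q}$ by $\tau(F)^{(p+q)/2}$. The twisted metric $h_\tau$ on $T_F(\mathcal M)\cong q_F$ is $h_\tau(\alpha,\beta)=\mathrm{Tr}(\alpha\beta^*)$, the adjoint being taken with respect to the twisted metric on $V_{\mathbb C}$. **Statement.**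 The twisted metric $h_\tau$ on $\mathcal M$ is $G_{\mathbb R}$-invariant: for any $g\in G_{\mathbb R}$ and $F\in\mathcal M$ one has $g.F\in\mathcal M$, and $$L_{g*}:T_F(\mathcal M)\to T_{g.F}(\mathcal M)$$ is a (bijective, $\mathbb C$-linear) isometry for $h_\tau$. -/

import Mathlib

open scoped TensorProduct

noncomputable section

namespace MixedHodge

/-! ### Complexification and complex conjugation -/

/-- The complexification `V_ℂ = ℂ ⊗ V` of a real vector space. -/
abbrev Cx (V : Type*) [AddCommGroup V] [Module ℝ V] : Type _ := ℂ ⊗[ℝ] V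

section Basic

variable {V : Type*} [AddCommGroup V] [Module ℝ V]

/-- Complex conjugation on `V_ℂ`, as a conjugate-linear map: `z ⊗ v ↦ z̄ ⊗ v`. -/
def conj : Cx V →ₛₗ[starRingEnd ℂ] Cx V where
  toFun := TensorProduct.map Complex.conjAe.toLinearMap (LinearMap.id : V →ₗ[ℝ] V)
  map_add' := map_add _
  map_smul' c x := by
    induction x using TensorProduct.induction_on with
    | zero => simp
    | tmul z v => simp [TensorProduct.smul_tmul']
    | add x y hx hy => simp only [smul_add, map_add, hx, hy]

theorem conj_tmul (z : ℂ) (v : V) : conj (z ⊗ₜ[ℝ] v) = (starRingEnd ℂ z) ⊗ₜ[ℝ] v := rfl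

theorem conj_conj (x : Cx V) : conj (conj x) = x := by
  induction x using TensorProduct.induction_on with
  | zero => simp
  | tmul z v => simp [conj_tmul]
  | add x y hx hy => simp only [map_add, hx, hy]

/-- The complex conjugate of a complex subspace of `V_ℂ` (conjugation is an involution, so its
image and its preimage agree). -/
def conjSub (S : Submodule ℂ (Cx V)) : Submodule ℂ (Cx V) := S.comap conj

/-- The graded quotient `Gr_w = W_w / W_{w-1}`. -/
abbrev Gr (W : ℤ → Submodule ℝ V) (w : ℤ) : Type _ :=
  ↥(W w) ⧸ (W (w - 1)).submoduleOf (W w)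

/-- The quotient map `W_w → Gr_w`, extended linearly (in an arbitrary way) to all of `V`; it is
only ever applied to elements of `W_w`, see `grMap_apply`. -/
def grMap (W : ℤ → Submodule ℝ V) (w : ℤ) : V →ₗ[ℝ] Gr W w :=
  ((W (w - 1)).submoduleOf (W w)).mkQ ∘ₗ (W w).subtype.leftInverse

theorem grMap_apply (W : ℤ → Submodule ℝ V) (w : ℤ) (v : V) (hv : v ∈ W w) :
    grMap W w v = Submodule.Quotient.mk ⟨v, hv⟩ := by
  have h := LinearMap.leftInverse_apply_of_inj (W w).ker_subtype ⟨v, hv⟩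
  simp only [Submodule.subtype_apply] at h
  simp [grMap, h]

/-- The complexification of `W_w`. -/
def WC (W : ℤ → Submodule ℝ V) (w : ℤ) : Submodule ℂ (Cx V) := (W w).baseChange ℂ

/-- The complexified quotient map `W_{w,ℂ} → Gr_{w,ℂ}` (only ever applied to elements of
`W_{w,ℂ}`). -/
def grC (W : ℤ → Submodule ℝ V) (w : ℤ) : Cx V →ₗ[ℂ] Cx (Gr W w) := (grMap W w).baseChange ℂ

/-- The filtration `F(Gr_w)` induced on `Gr_{w,ℂ}` by a filtration `F` of `V_ℂ`. -/
def inducedFiltration (W : ℤ → Submodule ℝ V) (F : ℤ → Submodule ℂ (Cx V)) (w : ℤ) :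
    ℤ → Submodule ℂ (Cx (Gr W w)) :=
  fun p ↦ (F p ⊓ WC W w).map (grC W w)

/-- `Φ` is a pure Hodge structure of weight `w` on `E`, polarized by `Q`, with Hodge numbers
`h p q` (`p + q = w`).  In the last condition the number `i^{p-q} Q(u, ū)` is automatically real,
since `Q` is `(-1)^w`-symmetric. -/
structure IsPolarizedHodgeStructure {E : Type*} [AddCommGroup E] [Module ℝ E] (w : ℤ)
    (Q : LinearMap.BilinForm ℝ E) (h : ℤ → ℤ → ℕ) (Φ : ℤ → Submodule ℂ (Cx E)) : Prop where
  opposed : ∀ p, IsCompl (Φ p) (conjSub (Φ (w + 1 - p)))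
  hodgeNumber : ∀ p q, p + q = w →
    Module.finrank ℂ ↥(Φ p ⊓ conjSub (Φ q)) = h p q
  isotropic : ∀ p q, w < p + q → ∀ u ∈ Φ p, ∀ v ∈ Φ q, Q.baseChange ℂ u v = 0
  positive : ∀ p q, p + q = w → ∀ u ∈ Φ p ⊓ conjSub (Φ q), u ≠ 0 →
    0 < (Complex.I ^ (p - q) * Q.baseChange ℂ u (conj u)).re

end Basic

/-! ### The classifying space -/

/-- The data that determine a classifying space of graded-polarized mixed Hodge structures on `V`:
a finite increasing filtration `W`, non-degenerate `(-1)^w`-symmetric forms on the graded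
quotients `Gr_w`, and Hodge numbers.  As `h^{p,q}_w` vanishes unless `w = p + q`, the Hodge
numbers are indexed by `(p, q)` alone. -/
structure ClassifyingData (V : Type*) [AddCommGroup V] [Module ℝ V] where
  W : ℤ → Submodule ℝ V
  W_mono : Monotone W
  W_bot : ∃ k, W k = ⊥
  W_top : ∃ k, W k = ⊤
  Q : ∀ w : ℤ, LinearMap.BilinForm ℝ (Gr W w)
  Q_nondegenerate : ∀ w, (Q w).Nondegenerate
  Q_symm : ∀ w x y, Q w x y = (-1 : ℝ) ^ w * Q w y x
  h : ℤ → ℤ → ℕ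
  h_symm : ∀ p q, h p q = h q p
  h_finite : ∀ w, {p | h p (w - p) ≠ 0}.Finite
  h_sum : ∀ w, Module.finrank ℝ (Gr W w) = ∑ᶠ p, h p (w - p)

namespace ClassifyingData

variable {V : Type*} [AddCommGroup V] [Module ℝ V] (D : ClassifyingData V)

/-- The complex bilinear extension to `Gr_{w,ℂ}` of the form on `Gr_w`, evaluated on the classes of
two elements of `W_{w,ℂ}`. -/
def QC (w : ℤ) (u v : Cx V) : ℂ := (D.Q w).baseChange ℂ (grC D.W w u) (grC D.W w v)

/-- The classifying space `M`: all finite decreasing filtrations `F` of `V_ℂ` such that `(F, W)` is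
a mixed Hodge structure whose graded quotients are Hodge structures polarized by the given forms
with the given Hodge numbers. -/
def M : Set (ℤ → Submodule ℂ (Cx V)) :=
  {F | Antitone F ∧ (∃ a, F a = ⊤) ∧ (∃ b, F b = ⊥) ∧
    ∀ w, IsPolarizedHodgeStructure w (D.Q w) D.h (inducedFiltration D.W F w)}

/-! ### The groups and the Lie algebra -/

/-- `G_ℝ`: real automorphisms that preserve `W` and induce isometries of the graded quotients. -/
def GR : Subgroup (V ≃ₗ[ℝ] V) where
  carrier := {g | (∀ w, (D.W w).map g.toLinearMap = D.W w) ∧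
    ∀ w, ∀ x ∈ D.W w, ∀ y ∈ D.W w,
      D.Q w (grMap D.W w (g x)) (grMap D.W w (g y)) = D.Q w (grMap D.W w x) (grMap D.W w y)}
  one_mem' := by
    refine ⟨fun w ↦ ?_, fun w x _ y _ ↦ rfl⟩
    exact Submodule.map_id _
  mul_mem' := by
    rintro a b ⟨ha, ha'⟩ ⟨hb, hb'⟩
    have hbm : ∀ w, ∀ x ∈ D.W w, b x ∈ D.W w := fun w x hx ↦ by
      rw [← hb w]; exact Submodule.mem_map_of_mem hx
    refine ⟨fun w ↦ ?_, fun w x hx y hy ↦ ?_⟩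
    · have : (a * b).toLinearMap = a.toLinearMap ∘ₗ b.toLinearMap := rfl
      rw [this, Submodule.map_comp, hb, ha]
    · rw [← hb' w x hx y hy, ← ha' w _ (hbm w x hx) _ (hbm w y hy)]
      rfl
  inv_mem' := by
    rintro a ⟨ha, ha'⟩
    have hinv : ∀ w, ∀ x ∈ D.W w, a⁻¹ x ∈ D.W w := fun w x hx ↦ by
      rw [← ha w] at hx
      obtain ⟨y, hy, rfl⟩ := hx
      have : a⁻¹ (a y) = y := a.symm_apply_apply y
      simpa [this] using hy
    have hcancel : ∀ x, a (a⁻¹ x) = x := fun x ↦ a.apply_symm_apply x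
    refine ⟨fun w ↦ ?_, fun w x hx y hy ↦ ?_⟩
    · apply le_antisymm
      · rintro _ ⟨x, hx, rfl⟩
        exact hinv w x hx
      · intro x hx
        refine ⟨a x, ?_, a.symm_apply_apply x⟩
        rw [← ha w]; exact Submodule.mem_map_of_mem hx
    · rw [← ha' w _ (hinv w x hx) _ (hinv w y hy), hcancel, hcancel]

/-- `G_ℂ`: complex automorphisms that preserve `W_ℂ` and induce isometries of the complexified
graded quotients. -/
def GC : Subgroup (Cx V ≃ₗ[ℂ] Cx V) where
  carrier := {g | (∀ w, (WC D.W w).map g.toLinearMap = WC D.W w) ∧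
    ∀ w, ∀ x ∈ WC D.W w, ∀ y ∈ WC D.W w, D.QC w (g x) (g y) = D.QC w x y}
  one_mem' := by
    refine ⟨fun w ↦ ?_, fun w x _ y _ ↦ rfl⟩
    exact Submodule.map_id _
  mul_mem' := by
    rintro a b ⟨ha, ha'⟩ ⟨hb, hb'⟩
    have hbm : ∀ w, ∀ x ∈ WC D.W w, b x ∈ WC D.W w := fun w x hx ↦ by
      rw [← hb w]; exact Submodule.mem_map_of_mem hx
    refine ⟨fun w ↦ ?_, fun w x hx y hy ↦ ?_⟩
    · have : (a * b).toLinearMap = a.toLinearMap ∘ₗ b.toLinearMap := rfl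
      rw [this, Submodule.map_comp, hb, ha]
    · rw [← hb' w x hx y hy, ← ha' w _ (hbm w x hx) _ (hbm w y hy)]
      rfl
  inv_mem' := by
    rintro a ⟨ha, ha'⟩
    have hinv : ∀ w, ∀ x ∈ WC D.W w, a⁻¹ x ∈ WC D.W w := fun w x hx ↦ by
      rw [← ha w] at hx
      obtain ⟨y, hy, rfl⟩ := hx
      have : a⁻¹ (a y) = y := a.symm_apply_apply y
      simpa [this] using hy
    have hcancel : ∀ x, a (a⁻¹ x) = x := fun x ↦ a.apply_symm_apply x
    refine ⟨fun w ↦ ?_, fun w x hx y hy ↦ ?_⟩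
    · apply le_antisymm
      · rintro _ ⟨x, hx, rfl⟩
        exact hinv w x hx
      · intro x hx
        refine ⟨a x, ?_, a.symm_apply_apply x⟩
        rw [← ha w]; exact Submodule.mem_map_of_mem hx
    · rw [← ha' w _ (hinv w x hx) _ (hinv w y hy), hcancel, hcancel]

variable {D} in
theorem GC_map_mem (g : D.GC) {w : ℤ} {x : Cx V} (hx : x ∈ WC D.W w) :
    (g : Cx V ≃ₗ[ℂ] Cx V) x ∈ WC D.W w := by
  rw [← g.2.1 w]; exact Submodule.mem_map_of_mem hx

variable {D} in
theorem GC_symm_mem (g : D.GC) {w : ℤ} {x : Cx V} (hx : x ∈ WC D.W w) :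
    (g : Cx V ≃ₗ[ℂ] Cx V).symm x ∈ WC D.W w := by
  have := GC_map_mem g⁻¹ hx
  exact this

/-- The inclusion `G_ℝ → G_ℂ`, `g ↦ id ⊗ g`. -/
def complexify (g : D.GR) : D.GC :=
  ⟨LinearEquiv.baseChange ℝ ℂ V V (g : V ≃ₗ[ℝ] V), by
    have hmem : ∀ w, ∀ x ∈ D.W w, (g : V ≃ₗ[ℝ] V) x ∈ D.W w := fun w x hx ↦ by
      rw [← g.2.1 w]; exact Submodule.mem_map_of_mem hx
    have happ : ∀ (z : ℂ) (v : V), (LinearEquiv.baseChange ℝ ℂ V V (g : V ≃ₗ[ℝ] V)) (z ⊗ₜ[ℝ] v)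
        = z ⊗ₜ[ℝ] ((g : V ≃ₗ[ℝ] V) v) := fun z v ↦ rfl
    refine ⟨fun w ↦ ?_, fun w x hx y hy ↦ ?_⟩
    · unfold WC
      conv_rhs => rw [← g.2.1 w]
      rw [Submodule.baseChange_eq_span, Submodule.map_span, Submodule.baseChange_eq_span]
      congr 1
      ext t
      constructor
      · rintro ⟨_, ⟨x, hx, rfl⟩, rfl⟩
        exact ⟨_, Submodule.mem_map_of_mem hx, rfl⟩
      · rintro ⟨_, ⟨x, hx, rfl⟩, rfl⟩
        exact ⟨_, ⟨x, hx, rfl⟩, rfl⟩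
    · unfold WC at hx hy
      rw [Submodule.baseChange_eq_span] at hx hy
      unfold QC
      induction hx using Submodule.span_induction with
      | zero => simp
      | add a b _ _ ha hb => simp only [map_add, LinearMap.add_apply, ha, hb]
      | smul c a _ ha => simp only [map_smul, LinearMap.smul_apply, ha]
      | mem a ha =>
        induction hy using Submodule.span_induction with
        | zero => simp
        | add a b _ _ ha hb => simp only [map_add, ha, hb]
        | smul c a _ ha => simp only [map_smul, ha]
        | mem b hb =>
          obtain ⟨a, ha, rfl⟩ := ha
          obtain ⟨b, hb, rfl⟩ := hb
          have := g.2.2 w a ha b hb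
          simp only [TensorProduct.mk_apply, happ, grC, LinearMap.baseChange_tmul,
            LinearMap.BilinForm.baseChange_tmul, this]⟩

/-- The Lie algebra `𝔤_ℂ` of `G_ℂ`: endomorphisms that preserve `W_ℂ` and act on the complexified
graded quotients by infinitesimal isometries. -/
def lieC : Submodule ℂ (Module.End ℂ (Cx V)) where
  carrier := {X | (∀ w, ∀ u ∈ WC D.W w, X u ∈ WC D.W w) ∧
    ∀ w, ∀ u ∈ WC D.W w, ∀ v ∈ WC D.W w, D.QC w (X u) v + D.QC w u (X v) = 0}
  zero_mem' := by
    refine ⟨fun w u _ ↦ by simp, fun w u _ v _ ↦ by simp [QC]⟩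
  add_mem' := by
    rintro X Y ⟨hX, hX'⟩ ⟨hY, hY'⟩
    refine ⟨fun w u hu ↦ add_mem (hX w u hu) (hY w u hu), fun w u hu v hv ↦ ?_⟩
    have h1 := hX' w u hu v hv
    have h2 := hY' w u hu v hv
    simp only [QC, LinearMap.add_apply, map_add] at *
    linear_combination h1 + h2
  smul_mem' := by
    rintro c X ⟨hX, hX'⟩
    refine ⟨fun w u hu ↦ Submodule.smul_mem _ c (hX w u hu), fun w u hu v hv ↦ ?_⟩
    have h1 := hX' w u hu v hv
    simp only [QC, LinearMap.smul_apply, map_smul, smul_eq_mul] at *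
    linear_combination c * h1

instance : AddCommGroup D.lieC := Submodule.addCommGroup D.lieC

variable {D}

/-- The adjoint action of `G_ℂ` on `𝔤_ℂ`, `X ↦ g X g⁻¹`. -/
def Ad (g : D.GC) : D.lieC →ₗ[ℂ] D.lieC :=
  (LinearEquiv.conj (g : Cx V ≃ₗ[ℂ] Cx V)).toLinearMap.restrict (by
    rintro X ⟨hX, hX'⟩
    refine ⟨fun w u hu ↦ GC_map_mem g (hX w _ (GC_symm_mem g hu)), fun w u hu v hv ↦ ?_⟩
    have hu' := GC_symm_mem g hu
    have hv' := GC_symm_mem g hv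
    have h1 := g.2.2 w _ (hX w _ hu') _ hv'
    have h2 := g.2.2 w _ hu' _ (hX w _ hv')
    rw [LinearEquiv.apply_symm_apply] at h1 h2
    have h3 := hX' w _ hu' _ hv'
    rw [← h1, ← h2] at h3
    exact h3)

/-- The action of linear automorphisms of `V_ℂ` on filtrations: `(g.F)^p = g(F^p)`. -/
def act (g : Cx V ≃ₗ[ℂ] Cx V) (F : ℤ → Submodule ℂ (Cx V)) : ℤ → Submodule ℂ (Cx V) :=
  fun p ↦ (F p).map g.toLinearMap

variable (D)

/-- The Lie algebra `𝔤_ℂ^F` of the stabilizer of `F` in `G_ℂ`. -/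
def stabilizer (F : ℤ → Submodule ℂ (Cx V)) : Submodule ℂ D.lieC where
  carrier := {X | ∀ p, ∀ v ∈ F p, (X : Module.End ℂ (Cx V)) v ∈ F p}
  zero_mem' := fun p v _ ↦ by simp
  add_mem' := fun {X Y} hX hY p v hv ↦ add_mem (hX p v hv) (hY p v hv)
  smul_mem' := fun c X hX p v hv ↦ Submodule.smul_mem _ c (hX p v hv)

/-- The (holomorphic) tangent space `T_F(M) = 𝔤_ℂ / 𝔤_ℂ^F`.  `M` is open in the homogeneous space
`G_ℂ / G_ℂ^F`, and the class of `X` is the velocity at `t = 0` of the curve `e^{tX}.F`. -/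
abbrev TangentSpace (F : ℤ → Submodule ℂ (Cx V)) : Type _ := ↥(D.lieC) ⧸ D.stabilizer F

variable {D}

/-- The differential `L_{g*} : T_F → T_{g.F}` of left translation by `g`; since
`g e^{tX}.F = e^{t Ad(g)X}.(g.F)`, it is induced by `Ad(g)`.  See `hasVelocity_act`. -/
def pushforward (g : D.GC) (F : ℤ → Submodule ℂ (Cx V)) :
    D.TangentSpace F →ₗ[ℂ] D.TangentSpace (act g F) :=
  Submodule.mapQ _ _ (Ad g) (by
    rintro X hX p _ ⟨v, hv, rfl⟩
    refine ⟨(X : Module.End ℂ (Cx V)) v, hX p v hv, ?_⟩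
    simp [Ad, LinearMap.restrict_apply, LinearEquiv.conj_apply])

/-- The curve `γ` through `F` has velocity `ξ` at `t = 0`: it is of the form `γ(t) = a(t).F` for a
curve `a` in `G_ℂ` through the identity whose derivative at `0` (in terms of matrix coefficients)
represents `ξ`. -/
def HasVelocity (γ : ℝ → ℤ → Submodule ℂ (Cx V)) (F : ℤ → Submodule ℂ (Cx V))
    (ξ : D.TangentSpace F) : Prop :=
  ∃ (a : ℝ → D.GC) (X : D.lieC), a 0 = 1 ∧ Submodule.Quotient.mk X = ξ ∧
    (∀ (v : Cx V) (φ : Module.Dual ℂ (Cx V)),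
      HasDerivAt (fun t ↦ φ ((a t : Cx V ≃ₗ[ℂ] Cx V) v)) (φ ((X : Module.End ℂ (Cx V)) v)) 0) ∧
    ∀ t, γ t = act (a t) F

/-- `pushforward g F` is the differential of `L_g` at `F`: it maps the velocity of a curve to the
velocity of the translated curve. -/
theorem hasVelocity_act (g : D.GC) (γ : ℝ → ℤ → Submodule ℂ (Cx V))
    (F : ℤ → Submodule ℂ (Cx V)) (ξ : D.TangentSpace F) (h : HasVelocity γ F ξ) :
    HasVelocity (fun t ↦ act g (γ t)) (act g F) (pushforward g F ξ) := by
  obtain ⟨a, X, ha, rfl, hd, hγ⟩ := h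
  refine ⟨fun t ↦ g * a t * g⁻¹, Ad g X, by simp [ha], rfl, fun v φ ↦ ?_, fun t ↦ ?_⟩
  · exact hd ((g : Cx V ≃ₗ[ℂ] Cx V).symm v) (φ ∘ₗ (g : Cx V ≃ₗ[ℂ] Cx V).toLinearMap)
  · funext p
    simp only [hγ, act]
    rw [← Submodule.map_comp, ← Submodule.map_comp]
    congr 1
    refine LinearMap.ext fun v ↦ ?_
    have hv : (g : Cx V ≃ₗ[ℂ] Cx V)⁻¹ ((g : Cx V ≃ₗ[ℂ] Cx V) v) = v :=
      (g : Cx V ≃ₗ[ℂ] Cx V).symm_apply_apply v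
    simp [hv]

/-! ### The Deligne bigrading -/

variable (D)

/-- Deligne's bigrading of the mixed Hodge structure `(F, W)`:
`I^{p,q} = F^p ∩ W_{p+q} ∩ (F̄^q ∩ W_{p+q} + ∑_{j ≥ 2} F̄^{q-j+1} ∩ W_{p+q-j})`.
It is the unique bigrading with `F^p = ⊕_{a ≥ p} I^{a,b}`, `W_k = ⊕_{a+b ≤ k} I^{a,b}` and
`I^{p,q} ≡ Ī^{q,p}` modulo `⊕_{r<p, s<q} I^{r,s}`. -/
def I (F : ℤ → Submodule ℂ (Cx V)) (p q : ℤ) : Submodule ℂ (Cx V) :=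
  F p ⊓ WC D.W (p + q) ⊓
    ((conjSub (F q) ⊓ WC D.W (p + q)) ⊔
      ⨆ j : ℤ, ⨆ _ : 2 ≤ j, conjSub (F (q - j + 1)) ⊓ WC D.W (p + q - j))

open Classical in
/-- The projection of `V_ℂ = ⊕ I^{p,q}` onto `I^{p,q}`. -/
def proj (F : ℤ → Submodule ℂ (Cx V)) (p q : ℤ) : Module.End ℂ (Cx V) :=
  if h : IsCompl (D.I F p q) (⨆ r : ℤ × ℤ, ⨆ _ : r ≠ (p, q), D.I F r.1 r.2) then
    Submodule.projection _ _ h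
  else 0

/-- The Hodge component `X^{p,q}` of an endomorphism `X` of `V_ℂ`: the part that maps every
`I^{r,s}` to `I^{r+p,s+q}`. -/
def component (F : ℤ → Submodule ℂ (Cx V)) (p q : ℤ) (X : Module.End ℂ (Cx V)) :
    Module.End ℂ (Cx V) :=
  ∑ᶠ r : ℤ × ℤ, D.proj F (r.1 + p) (r.2 + q) * X * D.proj F r.1 r.2

/-- The Deligne bigrading `𝔤^{p,q}` of the induced mixed Hodge structure on `𝔤_ℂ`. -/
def g (F : ℤ → Submodule ℂ (Cx V)) (p q : ℤ) : Submodule ℂ D.lieC where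
  carrier := {X | ∀ r s, ∀ v ∈ D.I F r s, (X : Module.End ℂ (Cx V)) v ∈ D.I F (r + p) (s + q)}
  zero_mem' := fun r s v _ ↦ by simp
  add_mem' := fun {X Y} hX hY r s v hv ↦ add_mem (hX r s v hv) (hY r s v hv)
  smul_mem' := fun c X hX r s v hv ↦ Submodule.smul_mem _ c (hX r s v hv)

/-- `q_F = ⊕_{p < 0, p + q ≤ 0} 𝔤^{p,q}`, a complement of `𝔤_ℂ^F` in `𝔤_ℂ`. -/
def qF (F : ℤ → Submodule ℂ (Cx V)) : Submodule ℂ D.lieC :=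
  ⨆ p : ℤ, ⨆ q : ℤ, ⨆ _ : p < 0 ∧ p + q ≤ 0, D.g F p q

/-- `X` belongs to `Λ^{-1,-1} = ⊕_{a,b<0} 𝔤𝔩(V_ℂ)^{a,b}`. -/
def InLambda (F : ℤ → Submodule ℂ (Cx V)) (X : Module.End ℂ (Cx V)) : Prop :=
  ∀ p q, ∀ v ∈ D.I F p q, X v ∈ ⨆ a : ℤ, ⨆ b : ℤ, ⨆ _ : a < p ∧ b < q, D.I F a b

/-- `(F, W)` is split over `ℝ`: `I^{p,q}` is the conjugate of `I^{q,p}`. -/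
def IsSplit (F : ℤ → Submodule ℂ (Cx V)) : Prop :=
  ∀ p q, D.I F p q = conjSub (D.I F q p)

/-! ### The canonical splitting -/

/-- Exponential of a nilpotent endomorphism. -/
def expN (X : Module.End ℂ (Cx V)) : Module.End ℂ (Cx V) := IsNilpotent.exp X

/-- The filtration `X.F` for an endomorphism `X` of `V_ℂ`. -/
def actEnd (X : Module.End ℂ (Cx V)) (F : ℤ → Submodule ℂ (Cx V)) : ℤ → Submodule ℂ (Cx V) :=
  fun p ↦ (F p).map X

/-- Deligne's `δ`-splitting: `δ` is real, lies in `Λ^{-1,-1}`, and `(e^{-iδ}.F, W)` is split over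
`ℝ`.  It is unique. -/
def IsDelta (F : ℤ → Submodule ℂ (Cx V)) (δ : Module.End ℝ V) : Prop :=
  D.InLambda F (δ.baseChange ℂ) ∧
    D.IsSplit (actEnd (expN (-(Complex.I • δ.baseChange ℂ))) F)

/-- The integers `b^k_{p,q}` with `(1 - x)^p (1 + x)^q = ∑_k b^k_{p,q} x^k`. -/
def b (k p q : ℕ) : ℤ :=
  ((1 - Polynomial.X) ^ p * (1 + Polynomial.X) ^ q : Polynomial ℤ).coeff k

/-- `C_{j+1}(η) = i ∑_{p,q ≥ 1} b^{j-1}_{p-1,q-1} η^{-p,-q}` for `j ≥ 1`; the argument `k` is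
`j - 1`, and `r = (p - 1, q - 1)`. -/
def C (F : ℤ → Submodule ℂ (Cx V)) (η : Module.End ℂ (Cx V)) (k : ℕ) : Module.End ℂ (Cx V) :=
  Complex.I • ∑ᶠ r : ℕ × ℕ,
    ((b k r.1 r.2 : ℤ) : ℂ) • D.component F (-((r.1 : ℤ) + 1)) (-((r.2 : ℤ) + 1)) η

/-- The noncommutative polynomials `P_k = P_k(C_2, …, C_{k+1})`: `P_0 = 1` and
`P_k = -(1/k) ∑_{j=1}^k P_{k-j} C_{j+1}`. -/
def P (F : ℤ → Submodule ℂ (Cx V)) (η : Module.End ℂ (Cx V)) : ℕ → Module.End ℂ (Cx V)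
  | 0 => 1
  | k + 1 => -((k + 1 : ℂ)⁻¹ • ∑ j : Fin (k + 1), P F η (k - j) * D.C F η j)

/-- The relation between `δ`, `ζ` and the auxiliary element `η`, which determines `ζ` and `η` as
universal Lie polynomials in the Hodge components of `δ`:  `ζ` and `η` are real, lie in
`Λ^{-1,-1}`, and `e^{iδ} = e^ζ (1 + ∑_{k ≥ 1} P_k(C_2, …, C_{k+1}))`.  The Hodge components are
taken with respect to the split mixed Hodge structure `(e^{-iδ}.F, W)`. -/
def IsZeta (F : ℤ → Submodule ℂ (Cx V)) (δ ζ η : Module.End ℝ V) : Prop :=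
  D.InLambda F (ζ.baseChange ℂ) ∧ D.InLambda F (η.baseChange ℂ) ∧
    expN (Complex.I • δ.baseChange ℂ) = expN (ζ.baseChange ℂ) *
      ∑ᶠ k, D.P (actEnd (expN (-(Complex.I • δ.baseChange ℂ))) F) (η.baseChange ℂ) k

/-- `ε = ε(F, W)` is the element of `Λ^{-1,-1}` with `e^ε = e^{iδ} e^{-ζ}`, so that
`(e^{-ε}.F, W)` is the canonical (`SL_2`) splitting of `(F, W)`. -/
def IsEpsilon (F : ℤ → Submodule ℂ (Cx V)) (ε : Module.End ℂ (Cx V)) : Prop :=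
  D.InLambda F ε ∧ ∃ δ ζ η : Module.End ℝ V, D.IsDelta F δ ∧ D.IsZeta F δ ζ η ∧
    expN ε = expN (Complex.I • δ.baseChange ℂ) * expN (-(ζ.baseChange ℂ))

open Classical in
/-- The element `ε(F, W)`, which exists uniquely for every mixed Hodge structure `(F, W)`. -/
def epsilon (F : ℤ → Submodule ℂ (Cx V)) : Module.End ℂ (Cx V) :=
  if h : ∃! ε, D.IsEpsilon F ε then h.choose else 0

/-! ### The standard and the twisted metric -/

/-- The hermitian form on `V_ℂ` for which the `I^{p,q}` are mutually orthogonal and which is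
`t^{p+q} i^{p-q} ⟨gr u, gr v̄⟩_{p+q}` for `u, v ∈ I^{p,q}`: the mixed Hodge metric, with the norm on
`I^{p,q}` scaled by `t^{(p+q)/2}`. -/
def scaledMetric (t : ℝ) (F : ℤ → Submodule ℂ (Cx V)) (u v : Cx V) : ℂ :=
  ∑ᶠ r : ℤ × ℤ, (t : ℂ) ^ (r.1 + r.2) * (Complex.I ^ (r.1 - r.2) *
    D.QC (r.1 + r.2) (D.proj F r.1 r.2 u) (conj (D.proj F r.1 r.2 v)))

/-- The mixed Hodge metric on `V_ℂ` (linear in the first variable). -/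
def hodgeMetric (F : ℤ → Submodule ℂ (Cx V)) : Cx V → Cx V → ℂ := D.scaledMetric 1 F

variable {D} in
open Classical in
/-- The adjoint `X^*` of `X` with respect to a (positive definite) hermitian form `H`: the unique
endomorphism with `H(Xu, v) = H(u, X^* v)`. -/
def adjoint (H : Cx V → Cx V → ℂ) (X : Module.End ℂ (Cx V)) : Module.End ℂ (Cx V) :=
  if h : ∃! Y : Module.End ℂ (Cx V), ∀ u v, H (X u) v = H u (Y v) then h.choose else 0

variable {D} in
/-- The hermitian form `(X, Y) ↦ Tr(X Y^*)` on `𝔤𝔩(V_ℂ)` that is induced by `H`. -/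
def traceForm (H : Cx V → Cx V → ℂ) (X Y : Module.End ℂ (Cx V)) : ℂ :=
  LinearMap.trace ℂ (Cx V) (X * adjoint H Y)

/-- The norm `‖X‖` of an endomorphism of `V_ℂ` for the standard metric at `F`. -/
def stdNorm (F : ℤ → Submodule ℂ (Cx V)) (X : Module.End ℂ (Cx V)) : ℝ :=
  √(traceForm (D.hodgeMetric F) X X).re

/-- The twisting function `τ(F) = 1 + ∑_{p,q<0} ‖ε^{p,q}‖^{-2/(p+q)}`, the Hodge components of
`ε = ε(F, W)` and the norm being taken with respect to `(F, W)`. -/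
def tau (F : ℤ → Submodule ℂ (Cx V)) : ℝ :=
  1 + ∑ᶠ (r : ℤ × ℤ) (_ : r.1 < 0 ∧ r.2 < 0),
    D.stdNorm F (D.component F r.1 r.2 (D.epsilon F)) ^ (-(2 : ℝ) / ((r.1 : ℝ) + (r.2 : ℝ)))

/-- The twisted metric on `V_ℂ` at `F`: the mixed Hodge metric with the norm on `I^{p,q}` scaled by
`τ(F)^{(p+q)/2}`. -/
def twistedMetric (F : ℤ → Submodule ℂ (Cx V)) : Cx V → Cx V → ℂ := D.scaledMetric (D.tau F) F

open Classical in
/-- The identification `T_F(M) ≅ q_F`: the unique representative of a tangent vector in `q_F`. -/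
def lift (F : ℤ → Submodule ℂ (Cx V)) (ξ : D.TangentSpace F) : Module.End ℂ (Cx V) :=
  if h : ∃! X : D.lieC, X ∈ D.qF F ∧ Submodule.Quotient.mk X = ξ then h.choose else 0

/-- The twisted metric `h_τ` on the tangent space `T_F(M) ≅ q_F ⊆ 𝔤𝔩(V_ℂ)`:
`h_τ(α, β) = Tr(α β^*)`, the adjoint being taken with respect to the twisted metric on `V_ℂ`. -/
def hTau (F : ℤ → Submodule ℂ (Cx V)) (ξ ξ' : D.TangentSpace F) : ℂ :=
  traceForm (D.twistedMetric F) (D.lift F ξ) (D.lift F ξ')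

end ClassifyingData

end MixedHodge

end

/-!
Every object that enters `h_τ` is determined by `F`, the filtration `W`, complex conjugation on
`V_ℂ` and the forms `⟨ , ⟩_w`, and a real `g` respects all of these. The subspaces `I^{p,q}` are
given by a lattice formula in `F`, `W` and `F̄`, so `g` carries `I^{p,q}_F` to `I^{p,q}_{g.F}`. The
objects defined by unique existence (`ε`, adjoints, the lift of a tangent vector to `q_F`) follow:
conjugation by `g` is a bijection which carries the characterizing property for `F` to the one for
`g.F`, so neither existence nor uniqueness has to be known. Hence `g` is an isometry from the
twisted metric at `F` to the one at `g.F`, the lift of `L_{g*} ξ` is the conjugate by `g` of the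
lift of `ξ`, and `Tr(α β^*)` does not change under conjugation by an isometry.
-/

namespace MixedHodge

section UniqueChoice

theorem dite_choose_existsUnique_equiv {α β γ δ : Type*} (e : α ≃ β) {P : α → Prop}
    {Q : β → Prop} {_ : Decidable (∃! a, P a)} {_ : Decidable (∃! b, Q b)}
    (h : ∀ a, Q (e a) ↔ P a) {f : β → δ} {k : α → γ} {φ : γ → δ} (hf : ∀ a, f (e a) = φ (k a))
    {c : γ} {d : δ} (hc : φ c = d) :
    (if hQ : ∃! b, Q b then f hQ.choose else d) =
      φ (if hP : ∃! a, P a then k hP.choose else c) := by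
  have hPQ : (∃! a, P a) ↔ ∃! b, Q b := e.existsUnique_congr fun a ↦ (h a).symm
  by_cases hP : ∃! a, P a
  · have hQ := hPQ.1 hP
    have hchoose : hQ.choose = e hP.choose :=
      hQ.unique hQ.choose_spec.1 ((h _).2 hP.choose_spec.1)
    rw [dif_pos hP, dif_pos hQ, hchoose, hf]
  · rw [dif_neg hP, dif_neg (mt hPQ.2 hP), hc]

end UniqueChoice

section LinearAlgebra

theorem isCompl_map_equiv_iff {R M N : Type*} [Ring R] [AddCommGroup M] [Module R M]
    [AddCommGroup N] [Module R N] (e : M ≃ₗ[R] N) {S T : Submodule R M} :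
    IsCompl (S.map e.toLinearMap) (T.map e.toLinearMap) ↔ IsCompl S T :=
  ((Submodule.orderIsoMapComap e).isCompl_iff (x := S) (y := T)).symm

theorem projection_map_equiv_apply {R M N : Type*} [Ring R] [AddCommGroup M] [Module R M]
    [AddCommGroup N] [Module R N] (e : M ≃ₗ[R] N) {S T : Submodule R M} (h : IsCompl S T)
    (h' : IsCompl (S.map e.toLinearMap) (T.map e.toLinearMap)) (x : M) :
    Submodule.projection _ _ h' (e x) = e (Submodule.projection _ _ h x) := by
  have hS : e (Submodule.projection _ _ h x) ∈ S.map e.toLinearMap :=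
    Submodule.mem_map_of_mem (Submodule.projection_apply_mem h x)
  have hT : e (Submodule.projection _ _ h.symm x) ∈ T.map e.toLinearMap :=
    Submodule.mem_map_of_mem (Submodule.projection_apply_mem h.symm x)
  conv_lhs => rw [← Submodule.projection_add_projection_eq_self h x, map_add, map_add]
  rw [Submodule.projection_apply_of_mem_left h' hS, Submodule.projection_apply_of_mem_right h' hT,
    add_zero]

theorem map_baseChange {R A M N : Type*} [CommSemiring R] [Semiring A] [Algebra R A]
    [AddCommMonoid M] [Module R M] [AddCommMonoid N] [Module R N] (f : M →ₗ[R] N)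
    (p : Submodule R M) :
    (p.baseChange A).map (f.baseChange A) = (p.map f).baseChange A := by
  simp only [Submodule.baseChange_eq_span, Submodule.map_span, Submodule.map_coe, Set.image_image,
    TensorProduct.mk_apply, LinearMap.baseChange_tmul]

theorem conjAlgEquiv_apply_apply {R M N : Type*} [CommSemiring R] [AddCommMonoid M] [Module R M]
    [AddCommMonoid N] [Module R N] (e : M ≃ₗ[R] N) (X : Module.End R M) (v : M) :
    e.conjAlgEquiv R X (e v) = e (X v) := by
  simp only [LinearEquiv.conjAlgEquiv_apply, LinearMap.comp_apply, LinearEquiv.coe_coe,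
    LinearEquiv.symm_apply_apply]

theorem baseChange_conjAlgEquiv {R A M N : Type*} [CommSemiring R] [CommSemiring A] [Algebra R A]
    [AddCommMonoid M] [Module R M] [AddCommMonoid N] [Module R N] (e : M ≃ₗ[R] N)
    (X : Module.End R M) :
    (e.conjAlgEquiv R X).baseChange A = (e.baseChange R A M N).conjAlgEquiv A (X.baseChange A) := by
  simp only [LinearEquiv.conjAlgEquiv_apply, LinearMap.baseChange_comp,
    LinearEquiv.coe_baseChange]
  rfl

/- An isomorphism preserves `nilpotencyClass`, also where this is the junk value `0`; compare
`IsNilpotent.map_exp`. -/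
theorem map_exp_of_ringEquivClass {A B E : Type*} [Ring A] [Module ℚ A] [Ring B] [Module ℚ B]
    [EquivLike E A B] [RingEquivClass E A B] (f : E) (a : A) :
    f (IsNilpotent.exp a) = IsNilpotent.exp (f a) := by
  have hclass : nilpotencyClass (f a) = nilpotencyClass a := by
    simp only [nilpotencyClass, ← map_pow, EmbeddingLike.map_eq_zero_iff]
  simp only [IsNilpotent.exp, hclass, map_sum, map_rat_smul, map_pow]

theorem baseChange_bilinForm_isometry {R A M N : Type*} [CommRing R] [CommRing A] [Algebra R A]
    [AddCommGroup M] [Module R M] [AddCommGroup N] [Module R N] {Q : LinearMap.BilinForm R M}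
    {Q' : LinearMap.BilinForm R N} {f : M →ₗ[R] N} (hf : ∀ x y, Q' (f x) (f y) = Q x y)
    (u v : A ⊗[R] M) :
    Q'.baseChange A (f.baseChange A u) (f.baseChange A v) = Q.baseChange A u v := by
  induction u using TensorProduct.induction_on with
  | zero => simp
  | add x y hx hy => simp only [map_add, LinearMap.add_apply, hx, hy]
  | tmul z x =>
    induction v using TensorProduct.induction_on with
    | zero => simp
    | add x y hx hy => simp only [map_add, hx, hy]
    | tmul z' y => simp only [LinearMap.baseChange_tmul, LinearMap.BilinForm.baseChange_tmul, hf]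

end LinearAlgebra

section Complexification

variable {V V' : Type*} [AddCommGroup V] [Module ℝ V] [AddCommGroup V'] [Module ℝ V']

/-- The complexification `id ⊗ f` of a real linear equivalence; for `g ∈ G_ℝ` it is the
automorphism underlying `D.complexify g`. -/
noncomputable abbrev cxEquiv (f : V ≃ₗ[ℝ] V') : Cx V ≃ₗ[ℂ] Cx V' := f.baseChange ℝ ℂ V V'

theorem conj_baseChange (f : V →ₗ[ℝ] V') (x : Cx V) :
    conj (f.baseChange ℂ x) = f.baseChange ℂ (conj x) := by
  induction x using TensorProduct.induction_on with
  | zero => simp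
  | tmul z v => simp [conj_tmul]
  | add x y hx hy => simp only [map_add, hx, hy]

theorem conj_cxEquiv (f : V ≃ₗ[ℝ] V') (x : Cx V) : conj (cxEquiv f x) = cxEquiv f (conj x) :=
  conj_baseChange f.toLinearMap x

theorem conjSub_map_cxEquiv (f : V ≃ₗ[ℝ] V') (S : Submodule ℂ (Cx V)) :
    conjSub (S.map (cxEquiv f).toLinearMap) = (conjSub S).map (cxEquiv f).toLinearMap := by
  ext x
  obtain ⟨y, rfl⟩ := (cxEquiv f).surjective x
  simp only [conjSub, Submodule.mem_comap, conj_cxEquiv, Submodule.mem_map_equiv,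
    LinearEquiv.symm_apply_apply]

theorem WC_le_conjSub_WC (W : ℤ → Submodule ℝ V) (w : ℤ) : WC W w ≤ conjSub (WC W w) := by
  rw [WC, Submodule.baseChange_eq_span, Submodule.span_le, ← Submodule.baseChange_eq_span]
  rintro _ ⟨v, hv, rfl⟩
  exact Submodule.tmul_mem_baseChange_of_mem _ hv

theorem IsPolarizedHodgeStructure.map {w : ℤ} {Q : LinearMap.BilinForm ℝ V}
    {Q' : LinearMap.BilinForm ℝ V'} {h : ℤ → ℤ → ℕ} {Φ : ℤ → Submodule ℂ (Cx V)}
    (H : IsPolarizedHodgeStructure w Q h Φ) (f : V ≃ₗ[ℝ] V')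
    (hf : ∀ x y, Q' (f x) (f y) = Q x y) :
    IsPolarizedHodgeStructure w Q' h fun p ↦ (Φ p).map (cxEquiv f).toLinearMap := by
  have hQ (u v : Cx V) :
      Q'.baseChange ℂ (cxEquiv f u) (cxEquiv f v) = Q.baseChange ℂ u v :=
    baseChange_bilinForm_isometry (f := f.toLinearMap) hf u v
  have hpiece (p q : ℤ) : (Φ p).map (cxEquiv f).toLinearMap ⊓
      conjSub ((Φ q).map (cxEquiv f).toLinearMap) =
        (Φ p ⊓ conjSub (Φ q)).map (cxEquiv f).toLinearMap := by
    rw [conjSub_map_cxEquiv, Submodule.map_inf _ (cxEquiv f).injective]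
  refine ⟨fun p ↦ ?_, fun p q hpq ↦ ?_, fun p q hpq ↦ ?_, fun p q hpq ↦ ?_⟩
  · rw [conjSub_map_cxEquiv, isCompl_map_equiv_iff]
    exact H.opposed p
  · rw [hpiece]
    exact (LinearEquiv.finrank_map_eq _ _).trans (H.hodgeNumber p q hpq)
  · rintro _ ⟨u, hu, rfl⟩ _ ⟨v, hv, rfl⟩
    exact (hQ u v).trans (H.isotropic p q hpq u hu v hv)
  · rw [hpiece]
    rintro _ ⟨u, hu, rfl⟩ hne
    have hu0 : u ≠ 0 := fun h0 ↦ hne (by rw [h0, map_zero])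
    simpa only [LinearEquiv.coe_coe, conj_cxEquiv, hQ] using H.positive p q hpq u hu hu0

end Complexification

section FilteredAutomorphism

variable {V : Type*} [AddCommGroup V] [Module ℝ V] {W : ℤ → Submodule ℝ V} {g : V ≃ₗ[ℝ] V}
  (hg : ∀ w, (W w).map g.toLinearMap = W w)

/-- The automorphism of `Gr_w` induced by an automorphism of `V` that preserves `W`. -/
noncomputable def grEquiv (w : ℤ) : Gr W w ≃ₗ[ℝ] Gr W w :=
  Submodule.Quotient.equiv _ _ (g.ofSubmodules (W w) (W w) (hg w)) (by
    ext y
    obtain ⟨x, rfl⟩ := (g.ofSubmodules (W w) (W w) (hg w)).surjective y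
    have hx : g x ∈ W (w - 1) ↔ (x : V) ∈ W (w - 1) := by
      conv_lhs => rw [← hg (w - 1), Submodule.mem_map_equiv, LinearEquiv.symm_apply_apply]
    simpa only [Submodule.mem_map_equiv, LinearEquiv.symm_apply_apply, Submodule.submoduleOf,
      Submodule.mem_comap, Submodule.subtype_apply, LinearEquiv.ofSubmodules_apply] using hx.symm)

theorem grEquiv_grMap {w : ℤ} {x : V} (hx : x ∈ W w) :
    grEquiv hg w (grMap W w x) = grMap W w (g x) := by
  have hgx : g x ∈ W w := hg w ▸ Submodule.mem_map_of_mem hx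
  rw [grMap_apply _ _ _ hx, grMap_apply _ _ _ hgx]
  rfl

theorem surjOn_grMap (W : ℤ → Submodule ℝ V) (w : ℤ) :
    Set.SurjOn (grMap W w) (W w) Set.univ := by
  intro y _
  obtain ⟨⟨x, hx⟩, rfl⟩ := Submodule.Quotient.mk_surjective _ y
  exact ⟨x, hx, grMap_apply _ _ _ hx⟩

include hg

theorem map_WC_cxEquiv (w : ℤ) : (WC W w).map (cxEquiv g).toLinearMap = WC W w := by
  rw [LinearEquiv.coe_baseChange, WC, map_baseChange, hg]

theorem grC_cxEquiv {w : ℤ} {x : Cx V} (hx : x ∈ WC W w) :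
    grC W w (cxEquiv g x) = cxEquiv (grEquiv hg w) (grC W w x) := by
  rw [WC, Submodule.baseChange_eq_span] at hx
  refine LinearMap.eqOn_span (f := grC W w ∘ₗ (cxEquiv g).toLinearMap)
    (g := (cxEquiv (grEquiv hg w)).toLinearMap ∘ₗ grC W w) ?_ hx
  rintro _ ⟨v, hv, rfl⟩
  exact congrArg (fun y ↦ (1 : ℂ) ⊗ₜ[ℝ] y) (grEquiv_grMap hg hv).symm

theorem inducedFiltration_act (F : ℤ → Submodule ℂ (Cx V)) (w p : ℤ) :
    inducedFiltration W (ClassifyingData.act (cxEquiv g) F) w p =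
      (inducedFiltration W F w p).map (cxEquiv (grEquiv hg w)).toLinearMap := by
  have hFW : ClassifyingData.act (cxEquiv g) F p ⊓ WC W w =
      (F p ⊓ WC W w).map (cxEquiv g).toLinearMap := by
    rw [Submodule.map_inf _ (cxEquiv g).injective, map_WC_cxEquiv hg, ClassifyingData.act]
  rw [inducedFiltration, inducedFiltration, hFW]
  simp only [← SetLike.coe_set_eq, Submodule.map_coe, Set.image_image, LinearEquiv.coe_coe]
  exact Set.image_congr fun x hx ↦ grC_cxEquiv hg hx.2

end FilteredAutomorphism

namespace ClassifyingData

section TransportByAutomorphism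

variable {V : Type*} [AddCommGroup V] [Module ℝ V] (e : Cx V ≃ₗ[ℂ] Cx V)

theorem expN_conjAlgEquiv (X : Module.End ℂ (Cx V)) :
    expN (e.conjAlgEquiv ℂ X) = e.conjAlgEquiv ℂ (expN X) :=
  (map_exp_of_ringEquivClass (e.conjAlgEquiv ℂ) X).symm

theorem actEnd_conjAlgEquiv_act (X : Module.End ℂ (Cx V)) (F : ℤ → Submodule ℂ (Cx V)) :
    actEnd (e.conjAlgEquiv ℂ X) (act e F) = act e (actEnd X F) := by
  funext p
  simp only [actEnd, act, ← Submodule.map_comp]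
  congr 1
  exact LinearMap.ext fun v ↦ conjAlgEquiv_apply_apply e X v

variable {e} {H H' : Cx V → Cx V → ℂ}

theorem adjoint_conjAlgEquiv (he : ∀ u v, H' (e u) (e v) = H u v) (X : Module.End ℂ (Cx V)) :
    adjoint H' (e.conjAlgEquiv ℂ X) = e.conjAlgEquiv ℂ (adjoint H X) := by
  have hadj (Y : Module.End ℂ (Cx V)) :
      (∀ u v, H' (e.conjAlgEquiv ℂ X u) v = H' u (e.conjAlgEquiv ℂ Y v)) ↔
        ∀ u v, H (X u) v = H u (Y v) := by
    conv_lhs => rw [e.surjective.forall₂]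
    simp only [conjAlgEquiv_apply_apply, he]
  exact dite_choose_existsUnique_equiv (e.conjAlgEquiv ℂ).toEquiv hadj (f := id) (k := id)
    (fun _ ↦ rfl) (map_zero (e.conjAlgEquiv ℂ))

theorem traceForm_conjAlgEquiv (he : ∀ u v, H' (e u) (e v) = H u v)
    (X Y : Module.End ℂ (Cx V)) :
    traceForm H' (e.conjAlgEquiv ℂ X) (e.conjAlgEquiv ℂ Y) = traceForm H X Y := by
  rw [traceForm, adjoint_conjAlgEquiv he, ← map_mul]
  exact LinearMap.trace_conj' _ e

end TransportByAutomorphism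

section FilteredAutomorphism

variable {V : Type*} [AddCommGroup V] [Module ℝ V] {D : ClassifyingData V} {g : V ≃ₗ[ℝ] V}
  (hg : ∀ w, (D.W w).map g.toLinearMap = D.W w) (F : ℤ → Submodule ℂ (Cx V))

include hg

theorem I_act (p q : ℤ) :
    D.I (act (cxEquiv g) F) p q = (D.I F p q).map (cxEquiv g).toLinearMap := by
  simp only [I, Submodule.map_inf _ (cxEquiv g).injective, Submodule.map_sup, Submodule.map_iSup,
    act, conjSub_map_cxEquiv, map_WC_cxEquiv hg]

theorem cxEquiv_mem_I_act_iff (p q : ℤ) (v : Cx V) :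
    cxEquiv g v ∈ D.I (act (cxEquiv g) F) p q ↔ v ∈ D.I F p q := by
  rw [I_act hg, Submodule.mem_map_equiv, LinearEquiv.symm_apply_apply]

theorem proj_act (p q : ℤ) :
    D.proj (act (cxEquiv g) F) p q = (cxEquiv g).conjAlgEquiv ℂ (D.proj F p q) := by
  have hsup : (⨆ r : ℤ × ℤ, ⨆ _ : r ≠ (p, q), D.I (act (cxEquiv g) F) r.1 r.2) =
      (⨆ r : ℤ × ℤ, ⨆ _ : r ≠ (p, q), D.I F r.1 r.2).map (cxEquiv g).toLinearMap := by
    simp only [Submodule.map_iSup, I_act hg]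
  unfold proj
  rw! [hsup, I_act hg]
  by_cases h : IsCompl (D.I F p q) (⨆ r : ℤ × ℤ, ⨆ _ : r ≠ (p, q), D.I F r.1 r.2)
  · have h' := (isCompl_map_equiv_iff (cxEquiv g)).2 h
    rw [dif_pos h, dif_pos h']
    refine LinearMap.ext fun x ↦ ?_
    obtain ⟨y, rfl⟩ := (cxEquiv g).surjective x
    rw [conjAlgEquiv_apply_apply, projection_map_equiv_apply (cxEquiv g) h h']
  · rw [dif_neg h, dif_neg (mt (isCompl_map_equiv_iff (cxEquiv g)).1 h), map_zero]

theorem component_act (p q : ℤ) (X : Module.End ℂ (Cx V)) :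
    D.component (act (cxEquiv g) F) p q ((cxEquiv g).conjAlgEquiv ℂ X) =
      (cxEquiv g).conjAlgEquiv ℂ (D.component F p q X) := by
  simp only [component, AddEquivClass.map_finsum, proj_act hg, map_mul]

theorem inLambda_act_iff (X : Module.End ℂ (Cx V)) :
    D.InLambda (act (cxEquiv g) F) ((cxEquiv g).conjAlgEquiv ℂ X) ↔ D.InLambda F X := by
  refine forall₂_congr fun p q ↦ ?_
  rw [(cxEquiv g).surjective.forall]
  simp only [conjAlgEquiv_apply_apply, I_act hg, ← Submodule.map_iSup, Submodule.mem_map_equiv,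
    LinearEquiv.symm_apply_apply]

theorem isSplit_act_iff : D.IsSplit (act (cxEquiv g) F) ↔ D.IsSplit F := by
  simp only [IsSplit, I_act hg, conjSub_map_cxEquiv,
    (Submodule.map_injective_of_injective (cxEquiv g).injective).eq_iff]

theorem C_act (η : Module.End ℂ (Cx V)) (k : ℕ) :
    D.C (act (cxEquiv g) F) ((cxEquiv g).conjAlgEquiv ℂ η) k =
      (cxEquiv g).conjAlgEquiv ℂ (D.C F η k) := by
  simp only [C, map_smul, AddEquivClass.map_finsum, component_act hg]

theorem P_act (η : Module.End ℂ (Cx V)) (k : ℕ) :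
    D.P (act (cxEquiv g) F) ((cxEquiv g).conjAlgEquiv ℂ η) k =
      (cxEquiv g).conjAlgEquiv ℂ (D.P F η k) := by
  induction k using Nat.strong_induction_on with
  | _ k ih =>
    cases k with
    | zero => rw [P, P, map_one]
    | succ k =>
      have hterm (j : Fin (k + 1)) := ih (k - j) (by lia)
      simp only [P, map_neg, map_smul, map_sum, map_mul, C_act hg, hterm]

omit hg in
theorem actEnd_expN_neg_I_smul_act (δ : Module.End ℝ V) :
    actEnd (expN (-(Complex.I • (g.conjAlgEquiv ℝ δ).baseChange ℂ))) (act (cxEquiv g) F) =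
      act (cxEquiv g) (actEnd (expN (-(Complex.I • δ.baseChange ℂ))) F) := by
  rw [baseChange_conjAlgEquiv, ← map_smul, ← map_neg, expN_conjAlgEquiv, actEnd_conjAlgEquiv_act]

theorem isDelta_act_iff (δ : Module.End ℝ V) :
    D.IsDelta (act (cxEquiv g) F) (g.conjAlgEquiv ℝ δ) ↔ D.IsDelta F δ := by
  rw [IsDelta, actEnd_expN_neg_I_smul_act, isSplit_act_iff hg, baseChange_conjAlgEquiv,
    inLambda_act_iff hg, IsDelta]

theorem isZeta_act_iff (δ ζ η : Module.End ℝ V) :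
    D.IsZeta (act (cxEquiv g) F) (g.conjAlgEquiv ℝ δ) (g.conjAlgEquiv ℝ ζ)
      (g.conjAlgEquiv ℝ η) ↔ D.IsZeta F δ ζ η := by
  rw [IsZeta, actEnd_expN_neg_I_smul_act]
  simp only [baseChange_conjAlgEquiv, inLambda_act_iff hg, P_act hg, ← map_smul,
    expN_conjAlgEquiv, ← AddEquivClass.map_finsum, ← map_mul, EmbeddingLike.apply_eq_iff_eq,
    IsZeta]

theorem isEpsilon_act_iff (ε : Module.End ℂ (Cx V)) :
    D.IsEpsilon (act (cxEquiv g) F) ((cxEquiv g).conjAlgEquiv ℂ ε) ↔ D.IsEpsilon F ε := by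
  have hs := (g.conjAlgEquiv ℝ).surjective
  rw [IsEpsilon, hs.exists, IsEpsilon, inLambda_act_iff hg]
  refine and_congr_right' (exists_congr fun δ ↦ ?_)
  rw [hs.exists₂]
  simp only [isDelta_act_iff hg, isZeta_act_iff hg, baseChange_conjAlgEquiv, ← map_smul,
    ← map_neg, expN_conjAlgEquiv, ← map_mul, EmbeddingLike.apply_eq_iff_eq]

theorem epsilon_act :
    D.epsilon (act (cxEquiv g) F) = (cxEquiv g).conjAlgEquiv ℂ (D.epsilon F) :=
  dite_choose_existsUnique_equiv ((cxEquiv g).conjAlgEquiv ℂ).toEquiv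
    (isEpsilon_act_iff hg F) (f := id) (k := id) (fun _ ↦ rfl)
    (map_zero ((cxEquiv g).conjAlgEquiv ℂ))

end FilteredAutomorphism

section Metric

variable {V : Type*} [AddCommGroup V] [Module ℝ V] {D : ClassifyingData V}

theorem proj_mem_WC (F : ℤ → Submodule ℂ (Cx V)) (p q : ℤ) (v : Cx V) :
    D.proj F p q v ∈ WC D.W (p + q) := by
  unfold proj
  split_ifs with h
  · exact (Submodule.projection_apply_mem h v).1.2
  · exact zero_mem _

variable (g : D.GR) (F : ℤ → Submodule ℂ (Cx V))

theorem QC_cxEquiv {w : ℤ} {u v : Cx V} (hu : u ∈ WC D.W w) (hv : v ∈ WC D.W w) :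
    D.QC w (cxEquiv g.1 u) (cxEquiv g.1 v) = D.QC w u v :=
  (D.complexify g).2.2 w u hu v hv

theorem scaledMetric_act (t : ℝ) (u v : Cx V) :
    D.scaledMetric t (act (cxEquiv g.1) F) (cxEquiv g.1 u) (cxEquiv g.1 v) =
      D.scaledMetric t F u v := by
  refine finsum_congr fun r ↦ ?_
  simp only [proj_act g.2.1, conjAlgEquiv_apply_apply, conj_cxEquiv]
  rw [QC_cxEquiv g (proj_mem_WC F _ _ u) (WC_le_conjSub_WC _ _ (proj_mem_WC F _ _ v))]

theorem stdNorm_act (X : Module.End ℂ (Cx V)) :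
    D.stdNorm (act (cxEquiv g.1) F) ((cxEquiv g.1).conjAlgEquiv ℂ X) = D.stdNorm F X := by
  rw [stdNorm, traceForm_conjAlgEquiv (H := D.hodgeMetric F)
    (H' := D.hodgeMetric (act (cxEquiv g.1) F)) (scaledMetric_act g F 1), stdNorm]

theorem tau_act : D.tau (act (cxEquiv g.1) F) = D.tau F := by
  simp only [tau, epsilon_act g.2.1, component_act g.2.1, stdNorm_act]

theorem twistedMetric_act (u v : Cx V) :
    D.twistedMetric (act (cxEquiv g.1) F) (cxEquiv g.1 u) (cxEquiv g.1 v) =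
      D.twistedMetric F u v := by
  rw [twistedMetric, tau_act, scaledMetric_act, twistedMetric]

end Metric

section ClassifyingSpace

variable {V : Type*} [AddCommGroup V] [Module ℝ V] {D : ClassifyingData V} (g : D.GR)

theorem grEquiv_isometry (w : ℤ) (x y : Gr D.W w) :
    D.Q w (grEquiv g.2.1 w x) (grEquiv g.2.1 w y) = D.Q w x y := by
  obtain ⟨x, hx, rfl⟩ := surjOn_grMap D.W w (Set.mem_univ x)
  obtain ⟨y, hy, rfl⟩ := surjOn_grMap D.W w (Set.mem_univ y)
  rw [grEquiv_grMap g.2.1 hx, grEquiv_grMap g.2.1 hy, g.2.2 w x hx y hy]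

theorem act_complexify_mem_M {F : ℤ → Submodule ℂ (Cx V)} (hF : F ∈ D.M) :
    act (D.complexify g) F ∈ D.M := by
  obtain ⟨hanti, ⟨a, ha⟩, ⟨b, hb⟩, hpol⟩ := hF
  refine ⟨fun p q hpq ↦ Submodule.map_mono (hanti hpq), ⟨a, ?_⟩, ⟨b, ?_⟩, fun w ↦ ?_⟩
  · rw [act, ha, Submodule.map_top, LinearEquiv.range]
  · rw [act, hb, Submodule.map_bot]
  · have hind := funext (inducedFiltration_act g.2.1 F w)
    exact hind ▸ (hpol w).map (grEquiv g.2.1 w) (grEquiv_isometry g w)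

end ClassifyingSpace

section TangentSpace

variable {V : Type*} [AddCommGroup V] [Module ℝ V] {D : ClassifyingData V}

theorem Ad_comp_Ad_inv (a : D.GC) : Ad a ∘ₗ Ad a⁻¹ = LinearMap.id := by
  ext X : 2
  exact (a.1.conjAlgEquiv ℂ).apply_symm_apply X

/-- The adjoint action of an element of `G_ℂ`, as an automorphism of the vector space `𝔤_ℂ`. -/
noncomputable def adEquiv (a : D.GC) : D.lieC ≃ₗ[ℂ] D.lieC :=
  LinearEquiv.ofLinearMap (Ad a) (Ad a⁻¹) (Ad_comp_Ad_inv a)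
    (by simpa only [inv_inv] using Ad_comp_Ad_inv a⁻¹)

theorem map_stabilizer_adEquiv (a : D.GC) (F : ℤ → Submodule ℂ (Cx V)) :
    (D.stabilizer F).map (adEquiv a).toLinearMap = D.stabilizer (act a F) := by
  ext Y
  obtain ⟨X, rfl⟩ := (adEquiv a).surjective Y
  rw [Submodule.mem_map_equiv, LinearEquiv.symm_apply_apply]
  change (∀ p, ∀ v ∈ F p, X.1 v ∈ F p) ↔
    ∀ p, ∀ v ∈ (F p).map a.1.toLinearMap, a.1.conjAlgEquiv ℂ X v ∈ (F p).map a.1.toLinearMap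
  refine forall_congr' fun p ↦ ?_
  conv_rhs => rw [a.1.surjective.forall]
  simp only [conjAlgEquiv_apply_apply, Submodule.mem_map_equiv, LinearEquiv.symm_apply_apply]

theorem pushforward_bijective (a : D.GC) (F : ℤ → Submodule ℂ (Cx V)) :
    Function.Bijective (pushforward a F) :=
  (Submodule.Quotient.equiv _ _ (adEquiv a) (map_stabilizer_adEquiv a F)).bijective

variable (g : D.GR) (F : ℤ → Submodule ℂ (Cx V))

theorem map_g_adEquiv (p q : ℤ) :
    (D.g F p q).map (adEquiv (D.complexify g)).toLinearMap =
      D.g (act (D.complexify g) F) p q := by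
  ext Y
  obtain ⟨X, rfl⟩ := (adEquiv (D.complexify g)).surjective Y
  rw [Submodule.mem_map_equiv, LinearEquiv.symm_apply_apply]
  change (∀ r s, ∀ v ∈ D.I F r s, X.1 v ∈ D.I F (r + p) (s + q)) ↔
    ∀ r s, ∀ v ∈ D.I (act (cxEquiv g.1) F) r s,
      (cxEquiv g.1).conjAlgEquiv ℂ X v ∈ D.I (act (cxEquiv g.1) F) (r + p) (s + q)
  refine forall₂_congr fun r s ↦ ?_
  conv_rhs => rw [(cxEquiv g.1).surjective.forall]
  simp only [conjAlgEquiv_apply_apply, cxEquiv_mem_I_act_iff g.2.1]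

theorem map_qF_adEquiv :
    (D.qF F).map (adEquiv (D.complexify g)).toLinearMap = D.qF (act (D.complexify g) F) := by
  simp only [qF, Submodule.map_iSup, map_g_adEquiv]

theorem lift_pushforward (ξ : D.TangentSpace F) :
    D.lift (act (D.complexify g) F) (pushforward (D.complexify g) F ξ) =
      (D.complexify g).1.conjAlgEquiv ℂ (D.lift F ξ) := by
  have hlift (X : D.lieC) :
      (adEquiv (D.complexify g) X ∈ D.qF (act (D.complexify g) F) ∧
        Submodule.Quotient.mk (adEquiv (D.complexify g) X) =
          pushforward (D.complexify g) F ξ) ↔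
        X ∈ D.qF F ∧ Submodule.Quotient.mk X = ξ := by
    rw [← map_qF_adEquiv, Submodule.mem_map_equiv, LinearEquiv.symm_apply_apply,
      ← (pushforward_bijective (D.complexify g) F).1.eq_iff]
    rfl
  exact dite_choose_existsUnique_equiv (adEquiv (D.complexify g)).toEquiv hlift
    (f := Subtype.val) (k := Subtype.val) (fun _ ↦ rfl) (map_zero _)

theorem hTau_pushforward (ξ ξ' : D.TangentSpace F) :
    D.hTau (act (D.complexify g) F) (pushforward (D.complexify g) F ξ)
      (pushforward (D.complexify g) F ξ') = D.hTau F ξ ξ' := by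
  rw [hTau, lift_pushforward, lift_pushforward]
  exact traceForm_conjAlgEquiv (e := (D.complexify g).1) (twistedMetric_act g F) _ _

end TangentSpace

end ClassifyingData

end MixedHodge

theorem mainTheorem11 {V : Type*} [AddCommGroup V] [Module ℝ V] [FiniteDimensional ℝ V]
    (D : MixedHodge.ClassifyingData V) (g : D.GR)
    (F : ℤ → Submodule ℂ (MixedHodge.Cx V)) (hF : F ∈ D.M) :
    MixedHodge.ClassifyingData.act (D.complexify g) F ∈ D.M ∧
    Function.Bijective (MixedHodge.ClassifyingData.pushforward (D.complexify g) F) ∧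
    ∀ ξ ξ' : D.TangentSpace F,
      D.hTau (MixedHodge.ClassifyingData.act (D.complexify g) F)
          (MixedHodge.ClassifyingData.pushforward (D.complexify g) F ξ)
          (MixedHodge.ClassifyingData.pushforward (D.complexify g) F ξ') =
        D.hTau F ξ ξ' :=
  ⟨MixedHodge.ClassifyingData.act_complexify_mem_M g hF,
    MixedHodge.ClassifyingData.pushforward_bijective (D.complexify g) F,
    MixedHodge.ClassifyingData.hTau_pushforward g F⟩
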